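/- Parallel bandit. Let $N\ge 2$ and $T\ge 1$ be integers and let $q=(q_1,\dots,q_N)\in[0,1]^N$. There are binary variables $X_1,\dots,X_N$ and a binary reward $Y$. The allowed actions are the empty intervention $do()$ and the interventions $do(X_i=j)$ with $1\le i\le N$ and $j\in\{0,1\}$. Under an action the $X_i$ are independent, $X_i\sim\mathrm{Bernoulli}(q_i)$ if $X_i$ is not intervened upon, $X_i=j$ under $do(X_i=j)$, and $\mathbb P(Y=1\mid X)=r(X)$ for a reward function $r:\{0,1\}^N\to[0,1]$. A strategy plays $T$ rounds; in each round it chooses an action, possibly at random, depending on the past actions and observations, and then observes $X_1,\dots,X_N$ and $Y$. After the $T$ rounds it outputs, possibly at random and depending on everything observed, an action $\hat a^*_T$. Let $\mu_a$ be the expected value of $Y$ under action $a$, let $\mu^*=\max_a\mu_a$, and let $R_T=\mu^*-\mathbb E[\mu_{\hat a^*_T}]$ be the simple regret. Put $I_\tau=\{i:\min\{q_i,1-q_i\}<1/\tau\}$ and $$m(q)=\min\{\tau\in\{2,\dots,N\}: |I_\tau|\le\tau\}.$$ Theorem. There is a universal constant $c>0$ such that for all $N\ge2$, all $T\ge 1$,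 all $q\in[0,1]^N$ and all strategies there is a reward function $r$ for which $$R_T\ \ge\ c\,\min\Bigl\{1,\sqrt{\frac{m(q)}{T}}\Bigr\}.$$ In particular, $R_T\ge c\sqrt{m(q)/T}$ whenever $T\ge m(q)$. -/

import Mathlib

namespace ParallelBandit

noncomputable section

/-- The Bernoulli distribution on `Bool`: `true` (the value `1`) has probability `p`. -/
def coin (p : unitInterval) : PMF Bool :=
  PMF.ofFintype (fun b => ENNReal.ofReal (if b then (p : ℝ) else 1 - (p : ℝ))) (by
    rw [Fintype.sum_bool, if_pos rfl, if_neg Bool.false_ne_true,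
      ← ENNReal.ofReal_add p.2.1 (sub_nonneg.2 p.2.2)]
    simp)

/-- The joint law of finitely many independent variables with given marginal laws. -/
def indep {N : ℕ} {α : Type} [Fintype α] (p : Fin N → PMF α) : PMF (Fin N → α) :=
  PMF.ofFintype (fun x => ∏ i, p i (x i)) (by
    classical
    have h : ∀ i, ∑ b, p i b = 1 := fun i => by rw [← tsum_fintype (L := .unconditional α)]; exact (p i).tsum_coe
    have := Finset.prod_univ_sum (fun _ : Fin N => (Finset.univ : Finset α)) (fun i b => p i b)
    simp only [h, Finset.prod_const_one, Fintype.piFinset_univ] at this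
    exact this.symm)

/-- Expectation of a real function under a distribution on a finite set. -/
def expect {α : Type} [Fintype α] (p : PMF α) (f : α → ℝ) : ℝ :=
  ∑ x, (p x).toReal * f x

/-- The allowed actions: `none` is the empty intervention `do()`, and `some (i, j)` is
the intervention `do(X_i = j)`. -/
abbrev Action (N : ℕ) : Type := Option (Fin N × Bool)

/-- The values `(X_1, …, X_N)` and `Y` of all variables in one round. -/
abbrev Outcome (N : ℕ) : Type := (Fin N → Bool) × Bool

/-- The law of `X_i` under an action: it is the constant `j` under `do(X_i = j)`, and
`Bernoulli (q_i)` under every action that does not intervene on `X_i`. -/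
def coordLaw {N : ℕ} (q : Fin N → unitInterval) (a : Action N) (i : Fin N) : PMF Bool :=
  match a with
  | none => coin (q i)
  | some (k, j) => if k = i then PMF.pure j else coin (q i)

/-- The law of `(X, Y)` under an action: the coordinates of `X` are independent, and
`Y` is `Bernoulli (r X)` given `X`. -/
def outcomeLaw {N : ℕ} (q : Fin N → unitInterval) (r : (Fin N → Bool) → unitInterval)
    (a : Action N) : PMF (Outcome N) :=
  (indep (coordLaw q a)).bind fun x => (coin (r x)).map fun y => (x, y)

/-- The expected reward `μ_a` of an action. -/
def meanReward {N : ℕ} (q : Fin N → unitInterval) (r : (Fin N → Bool) → unitInterval)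
    (a : Action N) : ℝ :=
  expect (outcomeLaw q r a) fun o => if o.2 then 1 else 0

/-- The optimal expected reward `μ^*`. -/
def optReward {N : ℕ} (q : Fin N → unitInterval) (r : (Fin N → Bool) → unitInterval) : ℝ :=
  Finset.univ.sup' Finset.univ_nonempty (meanReward q r)

/-- What the learner has seen in `t` rounds: the action and the outcome of each round. -/
abbrev History (N t : ℕ) : Type := Fin t → Action N × Outcome N

/-- A (possibly randomised) strategy for `T` rounds: the action of each round is drawn from a
law depending on the previous actions and outcomes, and after `T` rounds an estimate of the
optimal action is drawn from a law depending on all of them. -/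
structure Strategy (N T : ℕ) where
  /-- The law of the action in the round that follows the first `t` rounds. -/
  act : (t : Fin T) → History N t → PMF (Action N)
  /-- The law of the estimated optimal action. -/
  recommend : History N T → PMF (Action N)

/-- The law of the first `t` rounds when a strategy interacts with the environment `(q, r)`. -/
def historyLaw {N T : ℕ} (q : Fin N → unitInterval) (r : (Fin N → Bool) → unitInterval)
    (π : Strategy N T) : (t : ℕ) → t ≤ T → PMF (History N t)
  | 0, _ => PMF.pure Fin.elim0
  | t + 1, h => (historyLaw q r π t (Nat.le_of_succ_le h)).bind fun past =>
      (π.act ⟨t, h⟩ past).bind fun a =>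
        (outcomeLaw q r a).map fun o => Fin.snoc past (a, o)

/-- The law of the estimated optimal action after `T` rounds. -/
def recommendLaw {N T : ℕ} (q : Fin N → unitInterval) (r : (Fin N → Bool) → unitInterval)
    (π : Strategy N T) : PMF (Action N) :=
  (historyLaw q r π T le_rfl).bind π.recommend

/-- The simple regret `R_T`: the optimal expected reward minus the expectation of `μ_a` at the
estimated optimal action `a`. -/
def simpleRegret {N T : ℕ} (q : Fin N → unitInterval) (r : (Fin N → Bool) → unitInterval)
    (π : Strategy N T) : ℝ :=
  optReward q r - expect (recommendLaw q r π) (meanReward q r)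

/-- The set `I_τ` of variables `i` with `min {q_i, 1 - q_i} < 1 / τ`. -/
def unbalanced {N : ℕ} (q : Fin N → unitInterval) (τ : ℕ) : Finset (Fin N) :=
  Finset.univ.filter fun i => min (q i : ℝ) (1 - (q i : ℝ)) < 1 / (τ : ℝ)

/-- The number `m(q) = min {τ ∈ {2, …, N} : |I_τ| ≤ τ}` (for `2 ≤ N`, where `τ = N`
always qualifies). -/
def m {N : ℕ} (q : Fin N → unitInterval) : ℕ :=
  sInf {τ : ℕ | 2 ≤ τ ∧ τ ≤ N ∧ (unbalanced q τ).card ≤ τ}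

end

end ParallelBandit

/-! Every strategy is compared with itself in the environment where all rewards are fair coins. The
hard reward functions depend on one coordinate `k` only, with bias `ε` of order `min 1 √(m/T)`.
Passing from fair coins to `r` moves the expectation of a `[-1,1]`-valued function of the
recommendation by at most 8 times the KL divergence plus 1/8 (`expect_recommendLaw_sub_le`).

If `m = 2`, the rewards `1/2 ± ε`, signed by `X_k`, and their mirror image cannot both be served by
one recommendation (`exists_regret_ge_of_two_signs`). If `m ≥ 3`, minimality of `m` gives at least
`m` coordinates with a value of probability below `1/(m-1)`. By averaging, one of the interventions
forcing these values is rarely recommended and played only `O(T/m)` times under fair coins.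
Rewarding its value by `ε` adds divergence only in rounds that show this value, so the bonus goes
largely undetected (`exists_regret_ge_of_rare_value`). -/

namespace ParallelBandit

/-! ### Expectations on finite sets -/

section Expectation

variable {α β : Type} [Fintype α] [Fintype β]

theorem sum_toReal (p : PMF α) : ∑ x, (p x).toReal = 1 := by
  rw [← ENNReal.toReal_sum fun x _ => p.apply_ne_top x]
  have h := p.tsum_coe
  rw [tsum_fintype] at h
  simp [h]

theorem expect_const (p : PMF α) (c : ℝ) : expect p (fun _ => c) = c := by
  simp [expect, ← Finset.sum_mul, sum_toReal]

theorem expect_add (p : PMF α) (f g : α → ℝ) :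
    expect p (fun x => f x + g x) = expect p f + expect p g := by
  simp [expect, mul_add, Finset.sum_add_distrib]

theorem expect_sub (p : PMF α) (f g : α → ℝ) :
    expect p (fun x => f x - g x) = expect p f - expect p g := by
  simp [expect, mul_sub, Finset.sum_sub_distrib]

theorem expect_neg (p : PMF α) (f : α → ℝ) : expect p (fun x => - f x) = - expect p f := by
  simp [expect]

theorem expect_const_mul (p : PMF α) (c : ℝ) (f : α → ℝ) :
    expect p (fun x => c * f x) = c * expect p f := by
  simp only [expect, Finset.mul_sum]
  exact Finset.sum_congr rfl fun x _ => by ring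

theorem expect_sum {ι : Type} (s : Finset ι) (p : PMF α) (f : ι → α → ℝ) :
    expect p (fun x => ∑ i ∈ s, f i x) = ∑ i ∈ s, expect p (f i) := by
  simp only [expect, Finset.mul_sum]
  exact Finset.sum_comm

theorem expect_mono (p : PMF α) {f g : α → ℝ} (h : ∀ x, f x ≤ g x) : expect p f ≤ expect p g :=
  Finset.sum_le_sum fun x _ => mul_le_mul_of_nonneg_left (h x) ENNReal.toReal_nonneg

theorem expect_le_of_le (p : PMF α) {f : α → ℝ} {c : ℝ} (h : ∀ x, f x ≤ c) : expect p f ≤ c :=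
  (expect_mono p h).trans (expect_const p c).le

theorem le_expect_of_le (p : PMF α) {f : α → ℝ} {c : ℝ} (h : ∀ x, c ≤ f x) : c ≤ expect p f :=
  (expect_const p c).ge.trans (expect_mono p h)

theorem expect_bind (p : PMF α) (k : α → PMF β) (f : β → ℝ) :
    expect (p.bind k) f = expect p fun a => expect (k a) f := by
  have h : ∀ b, (p.bind k b).toReal = ∑ a, (p a).toReal * (k a b).toReal := fun b => by
    rw [PMF.bind_apply, tsum_fintype, ENNReal.toReal_sum fun a _ =>
      ENNReal.mul_ne_top (p.apply_ne_top a) ((k a).apply_ne_top b)]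
    simp
  simp only [expect, h, Finset.sum_mul, Finset.mul_sum]
  rw [Finset.sum_comm]
  exact Finset.sum_congr rfl fun a _ => Finset.sum_congr rfl fun b _ => by ring

theorem expect_pure (a : α) (f : α → ℝ) : expect (PMF.pure a) f = f a := by
  classical
  rw [expect, Finset.sum_eq_single a]
  · simp
  · intro b _ hb
    simp [PMF.pure_apply, hb]
  · simp

theorem expect_map (p : PMF α) (k : α → β) (f : β → ℝ) :
    expect (p.map k) f = expect p fun a => f (k a) := by
  rw [← PMF.bind_pure_comp, expect_bind]
  simp [expect_pure]

theorem expect_coin (p : unitInterval) (f : Bool → ℝ) :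
    expect (coin p) f = p * f true + (1 - p) * f false := by
  simp [expect, coin, ENNReal.toReal_ofReal p.2.1, ENNReal.toReal_ofReal (sub_nonneg.2 p.2.2)]

theorem expect_indep_coord {N : ℕ} (p : Fin N → PMF α) (k : Fin N) (f : α → ℝ) :
    expect (indep p) (fun x => f (x k)) = expect (p k) f := by
  classical
  have h := Finset.prod_univ_sum (fun _ : Fin N => (Finset.univ : Finset α))
    (fun i b => (p i b).toReal * if i = k then f b else 1)
  rw [Fintype.piFinset_univ] at h
  have h1 : ∏ i, ∑ b, ((p i b).toReal * if i = k then f b else 1) = expect (p k) f := by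
    rw [Finset.prod_eq_single k]
    · simp [expect]
    · intro i _ hi
      simp [hi, sum_toReal]
    · simp
  rw [← h1, h]
  refine Finset.sum_congr rfl fun x _ => ?_
  rw [Finset.prod_mul_distrib, Finset.prod_ite_eq' Finset.univ k]
  simp [indep, ENNReal.toReal_prod]

end Expectation

/-! ### One-coordinate rewards and change of measure -/

section Environments

variable {N T : ℕ} (q : Fin N → unitInterval)

theorem expect_outcomeLaw (r : (Fin N → Bool) → unitInterval) (a : Action N)
    (f : Outcome N → ℝ) :
    expect (outcomeLaw q r a) f =
      expect (indep (coordLaw q a)) fun x => r x * f (x, true) + (1 - r x) * f (x, false) := by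
  rw [outcomeLaw, expect_bind]
  simp only [expect_map, expect_coin]

/-- The probability that `X_k = b` under the action `a`. -/
noncomputable def valueProb (k : Fin N) (b : Bool) (a : Action N) : ℝ :=
  expect (coordLaw q a k) fun c => if c = b then 1 else 0

theorem valueProb_do (k : Fin N) (b : Bool) : valueProb q k b (some (k, b)) = 1 := by
  simp [valueProb, coordLaw, expect_pure]

theorem valueProb_nonneg (k : Fin N) (b : Bool) (a : Action N) : 0 ≤ valueProb q k b a :=
  le_expect_of_le _ fun c => by split_ifs <;> norm_num

theorem valueProb_le_one (k : Fin N) (b : Bool) (a : Action N) : valueProb q k b a ≤ 1 :=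
  expect_le_of_le _ fun c => by split_ifs <;> norm_num

theorem valueProb_le_of_ne (k : Fin N) (b : Bool) {a : Action N} (h : a ≠ some (k, b)) :
    valueProb q k b a ≤ expect (coin (q k)) fun c => if c = b then 1 else 0 := by
  rcases a with _ | ⟨i, j⟩
  · exact le_rfl
  · by_cases hi : i = k
    · subst hi
      have hj : j ≠ b := fun hj => h (by rw [hj])
      simp only [valueProb, coordLaw, if_true, expect_pure, if_neg hj]
      exact le_expect_of_le _ fun c => by split_ifs <;> norm_num
    · simp [valueProb, coordLaw, hi]

theorem valueProb_false (k : Fin N) (a : Action N) :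
    valueProb q k false a = 1 - valueProb q k true a := by
  rw [eq_sub_iff_add_eq, valueProb, valueProb, ← expect_add]
  refine Eq.trans ?_ (expect_const (coordLaw q a k) 1)
  congr 1
  ext c
  cases c <;> simp

theorem expect_coord_ite (k : Fin N) (b : Bool) (a : Action N) (u v : ℝ) :
    expect (coordLaw q a k) (fun c => if c = b then u else v) =
      v + (u - v) * valueProb q k b a := by
  nth_rw 2 [← expect_const (coordLaw q a k) v]
  rw [valueProb, ← expect_const_mul, ← expect_add]
  congr 1
  ext c
  split_ifs <;> ring

/-- The point `1/2` of the unit interval. -/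
noncomputable def half : unitInterval := ⟨1 / 2, by norm_num, by norm_num⟩

theorem meanReward_coord (k : Fin N) (ρ : Bool → unitInterval) (a : Action N) :
    meanReward q (fun x => ρ (x k)) a = expect (coordLaw q a k) fun c => (ρ c : ℝ) := by
  rw [meanReward, expect_outcomeLaw]
  simpa using expect_indep_coord (coordLaw q a) k fun c => (ρ c : ℝ)

/-- The logarithmic likelihood ratio of an outcome, between the reward function `r` and the
constant reward function `1/2`. -/
noncomputable def logRatio (r : (Fin N → Bool) → unitInterval) (o : Outcome N) : ℝ :=
  Real.log (if o.2 then 2 * (r o.1 : ℝ) else 2 * (1 - (r o.1 : ℝ)))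

/-- The divergence of the Bernoulli law with parameter `p` from the fair coin. -/
noncomputable def coinDivergence (p : ℝ) : ℝ := - (Real.log (2 * p) + Real.log (2 * (1 - p))) / 2

/-- Either sign gives `-log (1 - 4ε²) / 2`, and `log y ≥ 1 - 1/y`. -/
theorem coinDivergence_le {ε p : ℝ} (hε : 0 ≤ ε) (hε' : ε ≤ 1 / 4) (h : p = 1 / 2 + ε ∨ p = 1 / 2 - ε) :
    coinDivergence p ≤ 4 * ε ^ 2 := by
  have h1 : coinDivergence p = - Real.log (1 - 4 * ε ^ 2) / 2 := by
    rw [coinDivergence, ← Real.log_mul]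
    · rcases h with rfl | rfl <;> ring_nf
    all_goals rcases h with rfl | rfl <;> nlinarith
  have h2 : 0 < 1 - 4 * ε ^ 2 := by nlinarith
  have h3 := Real.one_sub_inv_le_log_of_pos h2
  have h4 : (1 - 4 * ε ^ 2)⁻¹ ≤ 1 + 8 * ε ^ 2 := by
    rw [inv_le_iff_one_le_mul₀ h2]
    nlinarith [mul_nonneg (sq_nonneg ε) (show 0 ≤ 1 / 16 - ε ^ 2 by nlinarith)]
  rw [h1]
  linarith

theorem coinDivergence_half : coinDivergence (1 / 2) = 0 := by
  norm_num [coinDivergence]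

/-- The law of `X` does not depend on the reward function, so only the law of `Y` given `X_k`
contributes to the divergence. -/
theorem expect_neg_logRatio_coord (k : Fin N) (ρ : Bool → unitInterval) (a : Action N) :
    expect (outcomeLaw q (fun _ => half) a) (fun o => - logRatio (fun x => ρ (x k)) o) =
      expect (coordLaw q a k) fun c => coinDivergence (ρ c) := by
  rw [expect_outcomeLaw, ← expect_indep_coord]
  congr 1
  ext x
  simp only [half, logRatio, coinDivergence, if_true, Bool.false_eq_true, if_false]
  ring

theorem expect_outcomeLaw_change {r : (Fin N → Bool) → unitInterval}
    (hr : ∀ x, 0 < (r x : ℝ) ∧ (r x : ℝ) < 1) (a : Action N) (f : Outcome N → ℝ) :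
    expect (outcomeLaw q r a) f =
      expect (outcomeLaw q (fun _ => half) a) fun o => Real.exp (logRatio r o) * f o := by
  rw [expect_outcomeLaw, expect_outcomeLaw]
  congr 1
  ext x
  have h1 := (hr x).1
  have h2 := sub_pos.2 (hr x).2
  simp only [half, logRatio, if_true, Bool.false_eq_true, if_false]
  rw [Real.exp_log (by linarith), Real.exp_log (by linarith)]
  ring

variable (π : Strategy N T)

theorem expect_historyLaw_succ (r : (Fin N → Bool) → unitInterval) {t : ℕ} (ht : t + 1 ≤ T)
    (f : History N (t + 1) → ℝ) :
    expect (historyLaw q r π (t + 1) ht) f =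
      expect (historyLaw q r π t (Nat.le_of_succ_le ht)) fun past =>
        expect (π.act ⟨t, ht⟩ past) fun a =>
          expect (outcomeLaw q r a) fun o => f (Fin.snoc past (a, o)) := by
  simp only [historyLaw, expect_bind, expect_map]

theorem sum_snoc {t : ℕ} (past : History N t) (z : Action N × Outcome N)
    (φ : Action N × Outcome N → ℝ) :
    ∑ i, φ ((Fin.snoc past z : History N (t + 1)) i) = ∑ i, φ (past i) + φ z := by
  simp [Fin.sum_univ_castSucc]

/-- The strategy's own randomisation and the law of `X` cancel in the likelihood ratio, leaving the
product of the reward ratios. -/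
theorem expect_historyLaw_change {r : (Fin N → Bool) → unitInterval}
    (hr : ∀ x, 0 < (r x : ℝ) ∧ (r x : ℝ) < 1) {t : ℕ} (ht : t ≤ T) (f : History N t → ℝ) :
    expect (historyLaw q r π t ht) f =
      expect (historyLaw q (fun _ => half) π t ht) fun h =>
        Real.exp (∑ i, logRatio r (h i).2) * f h := by
  induction t with
  | zero => simp [historyLaw, expect_pure]
  | succ t ih =>
    rw [expect_historyLaw_succ, expect_historyLaw_succ, ih]
    congr 1
    ext past
    rw [← expect_const_mul]
    congr 1
    ext a
    rw [expect_outcomeLaw_change q hr, ← expect_const_mul]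
    congr 1
    ext o
    rw [sum_snoc past (a, o) fun z => logRatio r z.2, Real.exp_add]
    ring

/-- With `φ` the negative log-ratio, this is the chain rule for the divergence. -/
theorem expect_historyLaw_sum_le (r : (Fin N → Bool) → unitInterval)
    {φ : Action N × Outcome N → ℝ} {κ : Action N → ℝ}
    (h : ∀ a, expect (outcomeLaw q r a) (fun o => φ (a, o)) ≤ κ a) {t : ℕ} (ht : t ≤ T) :
    expect (historyLaw q r π t ht) (fun h => ∑ i, φ (h i)) ≤
      expect (historyLaw q r π t ht) (fun h => ∑ i, κ (h i).1) := by
  induction t with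
  | zero => simp
  | succ t ih =>
    rw [expect_historyLaw_succ, expect_historyLaw_succ]
    simp only [sum_snoc _ _ φ, sum_snoc _ _ fun z => κ z.1, expect_add, expect_const]
    exact add_le_add (ih _) (expect_mono _ fun past => expect_mono _ h)

/-- A linear substitute for Pinsker's inequality. With `u = exp (s/2)`, `s ≤ 2(u-1)` gives `exp s -
1 - s ≥ (u-1)²`; then AM-GM applies to `|u-1|(u+1)`, with `(u+1)² ≤ 2(u²+1)`. -/
theorem abs_exp_sub_one_le_divergence (s : ℝ) :
    |Real.exp s - 1| ≤ 8 * (Real.exp s - 1 - s) + (Real.exp s + 1) / 16 := by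
  have h1 : Real.exp s = Real.exp (s / 2) ^ 2 := by
    rw [sq, ← Real.exp_add]
    ring_nf
  have h2 := Real.add_one_le_exp (s / 2)
  rw [h1, abs_le]
  generalize Real.exp (s / 2) = u at *
  constructor <;>
    nlinarith [sq_nonneg (16 * (u - 1) - (u + 1)), sq_nonneg (16 * (u - 1) + (u + 1)), sq_nonneg (u - 1)]

/-- Replacing the constant reward function `1/2` by `r` changes the expectation of a bounded
function of the recommendation by a controlled amount. -/
theorem expect_recommendLaw_sub_le {r : (Fin N → Bool) → unitInterval}
    (hr : ∀ x, 0 < (r x : ℝ) ∧ (r x : ℝ) < 1) {κ : Action N → ℝ}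
    (hκ : ∀ a, expect (outcomeLaw q (fun _ => half) a) (fun o => - logRatio r o) ≤ κ a)
    {f : Action N → ℝ} (hf : ∀ a, |f a| ≤ 1) :
    expect (recommendLaw q r π) f - expect (recommendLaw q (fun _ => half) π) f ≤
      8 * expect (historyLaw q (fun _ => half) π T le_rfl) (fun h => ∑ i, κ (h i).1) + 1 / 8 := by
  have hF : ∀ h, |expect (π.recommend h) f| ≤ 1 := fun h => by
    rw [abs_le]
    exact ⟨le_expect_of_le _ fun a => (abs_le.1 (hf a)).1,
      expect_le_of_le _ fun a => (abs_le.1 (hf a)).2⟩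
  -- The likelihood ratio has mean one, so `exp s - 1 - s` averages to the divergence and `(exp s +
  -- 1)/16` to 1/8.
  have h1 : expect (historyLaw q (fun _ => half) π T le_rfl)
      (fun h => Real.exp (∑ i, logRatio r (h i).2)) = 1 := by
    have := expect_historyLaw_change q π hr le_rfl fun _ => 1
    simpa [expect_const] using this.symm
  have hkl := expect_historyLaw_sum_le q π (fun _ => half) (φ := fun z => - logRatio r z.2) hκ le_rfl
  simp only [Finset.sum_neg_distrib, expect_neg] at hkl
  rw [recommendLaw, recommendLaw, expect_bind, expect_bind, expect_historyLaw_change q π hr,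
    ← expect_sub]
  refine (expect_mono _ (g := fun h => 8 * (Real.exp (∑ i, logRatio r (h i).2) - 1
    - ∑ i, logRatio r (h i).2) + 1 / 16 * (Real.exp (∑ i, logRatio r (h i).2) + 1))
    fun h => ?_).trans ?_
  · have h2 := abs_exp_sub_one_le_divergence (∑ i, logRatio r (h i).2)
    have h3 := abs_mul (Real.exp (∑ i, logRatio r (h i).2) - 1) (expect (π.recommend h) f)
    have h4 := mul_le_mul_of_nonneg_left (hF h)
      (abs_nonneg (Real.exp (∑ i, logRatio r (h i).2) - 1))
    have h5 := le_abs_self ((Real.exp (∑ i, logRatio r (h i).2) - 1) * expect (π.recommend h) f)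
    linarith
  · rw [expect_add, expect_const_mul, expect_const_mul, expect_sub, expect_sub, expect_add,
      expect_const, h1]
    linarith

theorem le_simpleRegret (r : (Fin N → Bool) → unitInterval) (a : Action N) :
    meanReward q r a - expect (recommendLaw q r π) (meanReward q r) ≤ simpleRegret q r π :=
  sub_le_sub_right (Finset.le_sup' (meanReward q r) (Finset.mem_univ a)) _

end Environments

/-! ### The two families of hard rewards -/

section LowerBounds

variable {N T : ℕ} (q : Fin N → unitInterval) (π : Strategy N T)

theorem exists_regret_ge_of_two_signs (k : Fin N) {ε : ℝ} (hε : 0 ≤ ε) (hε' : ε ≤ 1 / 4)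
    (hT : ε ^ 2 * T ≤ 1 / 256) : ∃ r, ε / 2 ≤ simpleRegret q r π := by
  let ρ : Bool → Bool → unitInterval := fun b c =>
    if c = b then ⟨1 / 2 + ε, by linarith, by linarith⟩ else ⟨1 / 2 - ε, by linarith, by linarith⟩
  have hρ : ∀ b c, (ρ b c : ℝ) = if c = b then 1 / 2 + ε else 1 / 2 - ε := fun b c => by
    simp only [ρ]
    split_ifs <;> rfl
  have hmean : ∀ b a, meanReward q (fun x => ρ b (x k)) a =
      1 / 2 + ε * (2 * valueProb q k b a - 1) := fun b a => by
    simp only [meanReward_coord, hρ, expect_coord_ite]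
    ring
  have hκ : ∀ b a, expect (outcomeLaw q (fun _ => half) a)
      (fun o => - logRatio (fun x => ρ b (x k)) o) ≤ 4 * ε ^ 2 := fun b a => by
    rw [expect_neg_logRatio_coord]
    refine expect_le_of_le _ fun c => coinDivergence_le hε hε' ?_
    rw [hρ]
    split_ifs <;> simp
  have hreg : ∀ b, ε * (2 - 1 / 4) - 2 * ε * expect (recommendLaw q (fun _ => half) π)
      (valueProb q k b) ≤ simpleRegret q (fun x => ρ b (x k)) π := fun b => by
    have h1 := le_simpleRegret q π (fun x => ρ b (x k)) (some (k, b))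
    have h2 := expect_recommendLaw_sub_le q π (r := fun x => ρ b (x k))
      (fun x => by rw [hρ]; split_ifs <;> constructor <;> linarith) (hκ b)
      (f := fun a => 2 * valueProb q k b a - 1) fun a => by
        have := valueProb_nonneg q k b a
        have := valueProb_le_one q k b a
        rw [abs_le]
        constructor <;> linarith
    simp only [expect_const, Finset.sum_const, Finset.card_univ, Fintype.card_fin, nsmul_eq_mul]
      at h2
    simp only [funext (hmean b), expect_add, expect_const, expect_const_mul, valueProb_do] at h1
    have h3 := expect_sub (recommendLaw q (fun _ => half) π)
      (fun a => 2 * valueProb q k b a) (fun _ => 1)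
    rw [expect_const, expect_const_mul] at h3
    rw [h3] at h2
    nlinarith [mul_le_mul_of_nonneg_left h2 hε]
  have hsum : expect (recommendLaw q (fun _ => half) π) (valueProb q k false) =
      1 - expect (recommendLaw q (fun _ => half) π) (valueProb q k true) := by
    rw [funext (valueProb_false q k), expect_sub, expect_const]
  -- Adding the two bounds cancels the recommendation terms and leaves `3ε/2`, more than twice
  -- `ε/2`.
  by_contra! hcon
  have h1 := hreg true
  have h2 := hreg false
  have h3 := hcon fun x => ρ true (x k)
  have h4 := hcon fun x => ρ false (x k)
  rw [hsum] at h2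
  linarith

/-- The expected number of rounds in which the action `a` is played when all rewards are fair
coins. -/
noncomputable def expectedPlays (a : Action N) : ℝ :=
  expect (historyLaw q (fun _ => half) π T le_rfl) fun h => ∑ i, if (h i).1 = a then 1 else 0

/-- The probability of recommending the action `a` when all rewards are fair coins. -/
noncomputable def recommendProb (a : Action N) : ℝ :=
  expect (recommendLaw q (fun _ => half) π) fun a' => if a' = a then 1 else 0

theorem sum_ite_eq_some_le (s : Finset (Fin N)) (b : Fin N → Bool) (a : Action N) :
    ∑ k ∈ s, (if a = some (k, b k) then 1 else 0 : ℝ) ≤ 1 := by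
  rcases a with _ | ⟨i, j⟩
  · simp
  · calc ∑ k ∈ s, (if (some (i, j) : Action N) = some (k, b k) then 1 else 0 : ℝ)
        ≤ ∑ k ∈ s, (if i = k then 1 else 0 : ℝ) := Finset.sum_le_sum fun k _ => by
          by_cases h : i = k <;> simp [h]
          split_ifs <;> norm_num
      _ ≤ 1 := by
          rw [Finset.sum_ite_eq]
          split_ifs <;> norm_num

theorem sum_recommendProb_le (s : Finset (Fin N)) (b : Fin N → Bool) :
    ∑ k ∈ s, recommendProb q π (some (k, b k)) ≤ 1 := by
  simp only [recommendProb]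
  rw [← expect_sum]
  exact expect_le_of_le _ fun a => sum_ite_eq_some_le s b a

theorem sum_expectedPlays_le (s : Finset (Fin N)) (b : Fin N → Bool) :
    ∑ k ∈ s, expectedPlays q π (some (k, b k)) ≤ T := by
  simp only [expectedPlays]
  rw [← expect_sum]
  refine expect_le_of_le _ fun h => ?_
  rw [Finset.sum_comm]
  exact (Finset.sum_le_sum fun i _ => sum_ite_eq_some_le s b (h i).1).trans (by simp)

theorem exists_regret_ge_of_rare_value (k : Fin N) (b : Bool) {ε δ : ℝ} (hε : 0 ≤ ε)
    (hε' : ε ≤ 1 / 4) (hδ : expect (coin (q k)) (fun c => if c = b then 1 else 0) ≤ δ)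
    (hδ0 : 0 ≤ δ) (hδ' : δ ≤ 1 / 2) (hrec : recommendProb q π (some (k, b)) ≤ 1 / 2)
    (hplays : ε ^ 2 * (expectedPlays q π (some (k, b)) + δ * T) ≤ 1 / 256) :
    ∃ r, ε / 8 ≤ simpleRegret q r π := by
  let ρ : Bool → unitInterval := fun c =>
    if c = b then ⟨1 / 2 + ε, by linarith, by linarith⟩ else half
  have hρ : ∀ c, (ρ c : ℝ) = if c = b then 1 / 2 + ε else 1 / 2 := fun c => by
    simp only [ρ]
    split_ifs <;> rfl
  have hval : ∀ a, valueProb q k b a ≤ (if a = some (k, b) then 1 else 0) + δ := fun a => by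
    split_ifs with h
    · linarith [valueProb_le_one q k b a]
    · linarith [valueProb_le_of_ne q k b h]
  have hmean : ∀ a, meanReward q (fun x => ρ (x k)) a = 1 / 2 + ε * valueProb q k b a :=
    fun a => by
    simp only [meanReward_coord, hρ, expect_coord_ite]
    ring
  have hbound : ∀ a, meanReward q (fun x => ρ (x k)) a ≤
      (1 / 2 + ε / 2) + ε / 2 * (if a = some (k, b) then 1 else 0) := fun a => by
    have h : valueProb q k b a ≤ 1 / 2 + 1 / 2 * (if a = some (k, b) then 1 else 0) := by
      split_ifs with h
      · linarith [valueProb_le_one q k b a]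
      · linarith [valueProb_le_of_ne q k b h]
    rw [hmean]
    linarith [mul_le_mul_of_nonneg_left h hε]
  have hκ : ∀ a, expect (outcomeLaw q (fun _ => half) a)
      (fun o => - logRatio (fun x => ρ (x k)) o) ≤
        4 * ε ^ 2 * ((if a = some (k, b) then 1 else 0) + δ) := fun a => by
    rw [expect_neg_logRatio_coord]
    refine le_trans (expect_mono _ (g := fun c => if c = b then 4 * ε ^ 2 else 0) fun c => ?_) ?_
    · rw [hρ]
      split_ifs
      · exact coinDivergence_le hε hε' (Or.inl rfl)
      · exact coinDivergence_half.le
    · rw [expect_coord_ite]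
      linarith [mul_le_mul_of_nonneg_left (hval a) (show 0 ≤ 4 * ε ^ 2 by positivity)]
  have h1 := le_simpleRegret q π (fun x => ρ (x k)) (some (k, b))
  have h2 := expect_recommendLaw_sub_le q π (r := fun x => ρ (x k))
    (fun x => by rw [hρ]; split_ifs <;> constructor <;> linarith) hκ
    (f := fun a => if a = some (k, b) then 1 else 0) fun a => by split_ifs <;> norm_num
  have h3 := expect_mono (recommendLaw q (fun x => ρ (x k)) π) hbound
  rw [expect_add, expect_const, expect_const_mul] at h3
  rw [hmean, valueProb_do] at h1
  simp only [← Finset.mul_sum, expect_const_mul, Finset.sum_add_distrib, expect_add, expect_const,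
    Finset.sum_const, Finset.card_univ, Fintype.card_fin, nsmul_eq_mul] at h2
  change _ - recommendProb q π (some (k, b)) ≤
    8 * (4 * ε ^ 2 * (expectedPlays q π (some (k, b)) + _)) + 1 / 8 at h2
  refine ⟨fun x => ρ (x k), ?_⟩
  -- 3/4 = 1/2 under fair coins, plus 1/8 from the divergence, plus 1/8 from the change of measure.
  have h4 : expect (recommendLaw q (fun x => ρ (x k)) π)
      (fun a => if a = some (k, b) then 1 else 0) ≤ 3 / 4 := by linarith
  linarith [mul_le_mul_of_nonneg_left h4 hε]

theorem exists_rare_value {τ : ℕ} {k : Fin N} (hk : k ∈ unbalanced q τ) :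
    ∃ b, expect (coin (q k)) (fun c => if c = b then 1 else 0) ≤ 1 / (τ : ℝ) := by
  rcases min_lt_iff.1 (Finset.mem_filter.1 hk).2 with h | h
  · exact ⟨true, by simpa [expect_coin] using h.le⟩
  · exact ⟨false, by simpa [expect_coin] using h.le⟩

theorem m_mem (hN : 2 ≤ N) : m q ∈ {τ : ℕ | 2 ≤ τ ∧ τ ≤ N ∧ (unbalanced q τ).card ≤ τ} :=
  Nat.sInf_mem ⟨N, hN, le_rfl, (Finset.card_le_univ _).trans (Fintype.card_fin N).le⟩

/-- Since `m ≥ 3`, `m - 1` is still in the admissible range, so by minimality it must fail the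
cardinality test. -/
theorem m_le_card_unbalanced (hN : 2 ≤ N) (hm : 3 ≤ m q) :
    m q ≤ (unbalanced q (m q - 1)).card := by
  by_contra! h
  have hmem : m q - 1 ∈ {τ : ℕ | 2 ≤ τ ∧ τ ≤ N ∧ (unbalanced q τ).card ≤ τ} :=
    ⟨by omega, by have := (m_mem q hN).2.1; omega, by omega⟩
  have := Nat.sInf_le hmem
  change m q ≤ m q - 1 at this
  omega

theorem exists_rare_value_seldom_played (hN : 2 ≤ N) (hT : 1 ≤ T) (hm : 3 ≤ m q) :
    ∃ k b, expect (coin (q k)) (fun c => if c = b then 1 else 0) ≤ 1 / ((m q - 1 : ℕ) : ℝ) ∧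
      recommendProb q π (some (k, b)) ≤ 1 / 2 ∧
      expectedPlays q π (some (k, b)) ≤ 6 * (T / m q : ℝ) := by
  have hcard := m_le_card_unbalanced q hN hm
  choose! b hb using fun k => exists_rare_value q (τ := m q - 1) (k := k)
  have hT' : (1 : ℝ) ≤ T := by exact_mod_cast hT
  have hm' : (3 : ℝ) ≤ m q := by exact_mod_cast hm
  have hcard' : (m q : ℝ) ≤ (unbalanced q (m q - 1)).card := by exact_mod_cast hcard
  have hne : (unbalanced q (m q - 1)).Nonempty := Finset.card_pos.1 (by omega)
  -- One weighted sum controls both quantities at the same `k`: the totals are at most 1 and `T`,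
  -- hence 5/4 together, shared by at least `m` indices.
  have hsum : ∑ k ∈ unbalanced q (m q - 1), (recommendProb q π (some (k, b k)) +
      1 / (4 * T) * expectedPlays q π (some (k, b k))) ≤
      ∑ _k ∈ unbalanced q (m q - 1), 5 / 4 * (1 / m q : ℝ) := by
    rw [Finset.sum_add_distrib, ← Finset.mul_sum, Finset.sum_const, nsmul_eq_mul]
    have h1 := sum_recommendProb_le q π (unbalanced q (m q - 1)) b
    have h2 := mul_le_mul_of_nonneg_left (sum_expectedPlays_le q π (unbalanced q (m q - 1)) b)
      (show 0 ≤ 1 / (4 * (T : ℝ)) by positivity)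
    have h3 : 1 / (4 * (T : ℝ)) * T = 1 / 4 := by field_simp
    have h4 : 1 ≤ ((unbalanced q (m q - 1)).card : ℝ) * (1 / m q) := by
      rw [mul_one_div, le_div_iff₀ (by linarith)]
      linarith
    linarith
  obtain ⟨k, hk, h⟩ := Finset.exists_le_of_sum_le hne hsum
  have h1 : 0 ≤ recommendProb q π (some (k, b k)) :=
    le_expect_of_le _ fun a => by split_ifs <;> norm_num
  have h2 : 0 ≤ expectedPlays q π (some (k, b k)) :=
    le_expect_of_le _ fun a => Finset.sum_nonneg fun i _ => by split_ifs <;> norm_num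
  refine ⟨k, b k, hb k hk, ?_, ?_⟩
  · have h3 : 0 ≤ 1 / (4 * T) * expectedPlays q π (some (k, b k)) := by positivity
    have h4 : 1 / (m q : ℝ) ≤ 1 / 3 := one_div_le_one_div_of_le (by norm_num) hm'
    linarith
  · have h3 : 1 / (4 * T) * expectedPlays q π (some (k, b k)) ≤ 5 / 4 * (1 / m q : ℝ) := by
      linarith
    have h4 := mul_le_mul_of_nonneg_left h3 (show 0 ≤ 4 * (T : ℝ) by positivity)
    have h5 : 4 * (T : ℝ) * (1 / (4 * T) * expectedPlays q π (some (k, b k))) =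
      expectedPlays q π (some (k, b k)) := by field_simp
    have h6 : 4 * (T : ℝ) * (5 / 4 * (1 / m q)) = 5 * (T / m q) := by ring
    have h7 : 0 ≤ (T / m q : ℝ) := by positivity
    linarith

end LowerBounds

end ParallelBandit

theorem theorem2 :
    ∃ c : ℝ, 0 < c ∧
      ∀ (N T : ℕ), 2 ≤ N → 1 ≤ T →
        ∀ (q : Fin N → unitInterval) (π : ParallelBandit.Strategy N T),
          ∃ r : (Fin N → Bool) → unitInterval,
            c * min 1 (Real.sqrt ((ParallelBandit.m q : ℝ) / (T : ℝ)))
              ≤ ParallelBandit.simpleRegret q r π := by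
  -- `ε = x/64` and the rare-value regret `ε/8` give 1/512.
  refine ⟨1 / 512, by norm_num, fun N T hN hT q π => ?_⟩
  set x : ℝ := min 1 (Real.sqrt ((ParallelBandit.m q : ℝ) / (T : ℝ))) with hx
  have hT' : (1 : ℝ) ≤ T := by exact_mod_cast hT
  have hm2 := (ParallelBandit.m_mem q hN).1
  have hx0 : 0 ≤ x := le_min zero_le_one (Real.sqrt_nonneg _)
  have hx1 : x ≤ 1 := min_le_left _ _
  have hx2 : x ^ 2 * T ≤ ParallelBandit.m q := by
    rw [← le_div_iff₀ (by linarith), ← Real.sq_sqrt (show 0 ≤ (ParallelBandit.m q : ℝ) / T by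
      positivity)]
    exact pow_le_pow_left₀ hx0 (min_le_right _ _) 2
  rcases hm2.eq_or_lt with hm | hm
  · rw [← hm] at hx2
    push_cast at hx2
    -- Any coordinate would do here.
    obtain ⟨r, hr⟩ := ParallelBandit.exists_regret_ge_of_two_signs q π ⟨0, by omega⟩
      (ε := x / 64) (by linarith) (by linarith) (by nlinarith)
    exact ⟨r, by linarith⟩
  · obtain ⟨k, b, hb, hrec, hplays⟩ :=
      ParallelBandit.exists_rare_value_seldom_played q π hN hT hm
    have hm' : (3 : ℝ) ≤ ParallelBandit.m q := by exact_mod_cast hm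
    have hcast : ((ParallelBandit.m q - 1 : ℕ) : ℝ) = ParallelBandit.m q - 1 := by
      rw [Nat.cast_sub (by omega), Nat.cast_one]
    rw [hcast] at hb
    have hinv : 1 / ((ParallelBandit.m q : ℝ) - 1) ≤ 3 / 2 * (1 / ParallelBandit.m q) := by
      rw [div_mul_div_comm, div_le_div_iff₀ (by linarith) (by linarith)]
      linarith
    have hratio : x ^ 2 * (T / ParallelBandit.m q) ≤ 1 := by
      rw [← mul_div_assoc, div_le_one (by linarith)]
      exact hx2
    obtain ⟨r, hr⟩ := ParallelBandit.exists_regret_ge_of_rare_value q π k b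
      (ε := x / 64) (by linarith) (by linarith) hb
      (one_div_nonneg.2 (by linarith))
      (one_div_le_one_div_of_le (by norm_num) (by linarith)) hrec (by
        have h1 := mul_le_mul_of_nonneg_right hinv (show 0 ≤ (T : ℝ) by linarith)
        have h2 : 3 / 2 * (1 / (ParallelBandit.m q : ℝ)) * T =
          3 / 2 * (T / ParallelBandit.m q) := by ring
        have h3 := mul_le_mul_of_nonneg_left
          (show ParallelBandit.expectedPlays q π (some (k, b)) +
            1 / ((ParallelBandit.m q : ℝ) - 1) * T ≤ 15 / 2 * (T / ParallelBandit.m q) by linarith)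
          (sq_nonneg (x / 64))
        refine h3.trans ?_
        rw [div_pow]
        linarith)
    exact ⟨r, by linarith⟩
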